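/- Let $\mathbb D=\{z\in\mathbb C:|z|<1\}$, let $1<p<\infty$ and $0<\beta\le \frac1p$, and let $\mu$ be the positive Borel measure on $[0,1)$ given by $d\mu(t)=\left(\log\frac{2}{1-t}\right)^{-\beta}dt$. Then $\mu$ is finite and is a $\beta$-logarithmic $1$-Carleson measure, that is, there is a constant $C>0$ such that $$\frac{\mu\big(S(I)\cap[0,1)\big)\left(\log\frac{2\pi}{|I|}\right)^{\beta}}{|I|}\le C\quad\text{for every arc } I\subset\partial\mathbb D \text{ of length } |I|>0,$$ where $S(I)=\{re^{i\theta}: e^{i\theta}\in I,\ 1-\frac{|I|}{2\pi}\le r<1\}$. For $n\ge 0$ put $\mu_n=\int_{[0,1)}t^n\,d\mu(t)$, and for $f(z)=\sum_{k\ge0}a_kz^k$ analytic in $\mathbb D$ let $$\mathcal H_\mu(f)(z)=\sum_{n=0}^\infty\Big(\sum_{k=0}^\infty\mu_{n+k}a_k\Big)z^n,$$ whenever all these series converge for every $z\in\mathbb D$. Let $B^p$ be the analytic Besov space of all functions $f$ analytic in $\mathbb D$ such that $$\|f\|_{B^p}=\Big(|f(0)|^p+\int_{\mathbb D}(1-|z|^2)^{p-2}|f'(z)|^p\,dA(z)\Big)^{1/p}<\infty,$$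 where $A$ is the normalized area measure on $\mathbb D$. Then $\mathcal H_\mu$ does not map $B^p$ into itself: there is $f\in B^p$ for which $\mathcal H_\mu(f)$ is well defined and analytic in $\mathbb D$ but $\mathcal H_\mu(f)\notin B^p$. -/

import Mathlib

open MeasureTheory Set Filter Topology
open scoped ENNReal

noncomputable section

/-- The closed Carleson square over the arc `{e^{iφ} : a ≤ φ ≤ a + l}` of length `l`:
the points `r e^{iφ}` with `1 - l / (2π) ≤ r < 1`. -/
def carlesonSquare (a l : ℝ) : Set ℂ :=
  {z : ℂ | ∃ r φ : ℝ, 1 - l / (2 * Real.pi) ≤ r ∧ r < 1 ∧ a ≤ φ ∧ φ ≤ a + l ∧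
    z = (r : ℂ) * Complex.exp ((φ : ℂ) * Complex.I)}

/-- A Borel measure `ν` on the unit disc is an `α`-logarithmic `s`-Carleson measure if
`ν (S(I)) * (log (2π / |I|)) ^ α / |I| ^ s` is bounded over all arcs `I` of the unit circle.
It suffices to let `I` run over closed arcs of length `0 < |I| ≤ 2π`, since any arc lies in a
closed arc of the same length. -/
def IsLogCarleson (α s : ℝ) (ν : Measure ℂ) : Prop :=
  ∃ C : ℝ, 0 < C ∧ ∀ a l : ℝ, 0 < l → l ≤ 2 * Real.pi →
    ν (carlesonSquare a l) * ENNReal.ofReal (Real.log (2 * Real.pi / l) ^ α)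
        / ENNReal.ofReal (l ^ s) ≤ ENNReal.ofReal C

/-- A Borel measure on `[0,1)` seen as a measure on the disc: `A ↦ μ (A ∩ [0,1))`. -/
def toDiscMeasure (μ : Measure ℝ) : Measure ℂ :=
  (μ.restrict (Ico (0 : ℝ) 1)).map (fun t : ℝ => (t : ℂ))

/-- The `n`-th moment of a measure on `[0,1)`. -/
def moment (μ : Measure ℝ) (n : ℕ) : ℝ :=
  ∫ t in Ico (0 : ℝ) 1, t ^ n ∂μ

/-- The `k`-th Taylor coefficient at the origin. -/
def taylorCoeff (f : ℂ → ℂ) (k : ℕ) : ℂ :=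
  iteratedDeriv k f 0 / (k.factorial : ℂ)

/-- `H_μ f` is well defined, and equals `F` on the unit disc: for each `n` the series
`∑ₖ μ_{n+k} aₖ` (with `aₖ` the Taylor coefficients of `f`) converges, to `c n` say, and
`F z = ∑ₙ c n * z ^ n` for all `z` in the disc, the power series being convergent there. -/
def IsHankelImage (μ : Measure ℝ) (f F : ℂ → ℂ) : Prop :=
  ∃ c : ℕ → ℂ,
    (∀ n : ℕ, Tendsto
      (fun N : ℕ => ∑ k ∈ Finset.range N, (moment μ (n + k) : ℂ) * taylorCoeff f k)
      atTop (𝓝 (c n))) ∧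
    ∀ z ∈ Metric.ball (0 : ℂ) 1, HasSum (fun n : ℕ => c n * z ^ n) (F z)

/-- `ρ_p(f) ^ p`, the integral of `(1 - |z|²)^(p-2) |f'(z)|^p` over the disc for the normalized
area measure. -/
def besovIntegral (p : ℝ) (f : ℂ → ℂ) : ℝ≥0∞ :=
  (ENNReal.ofReal Real.pi)⁻¹ * ∫⁻ z in Metric.ball (0 : ℂ) 1,
    ENNReal.ofReal ((1 - ‖z‖ ^ 2) ^ (p - 2) * ‖deriv f z‖ ^ p)

/-- The Besov norm `(|f(0)|^p + ρ_p(f)^p)^(1/p)`, with values in `[0,∞]`. -/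
def besovNorm (p : ℝ) (f : ℂ → ℂ) : ℝ≥0∞ :=
  (ENNReal.ofReal ‖f 0‖ ^ p + besovIntegral p f) ^ (1 / p)

/-- Membership in the analytic Besov space `B^p`. -/
def MemBesov (p : ℝ) (f : ℂ → ℂ) : Prop :=
  DifferentiableOn ℂ f (Metric.ball (0 : ℂ) 1) ∧ besovNorm p f < ∞

/-- The measure `(log (2 / (1 - t)))^(-β) dt` on `[0,1)`. -/
def logMeasure (β : ℝ) : Measure ℝ :=
  (volume.restrict (Ico (0 : ℝ) 1)).withDensity
    (fun t : ℝ => ENNReal.ofReal (Real.log (2 / (1 - t)) ^ (-β)))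

end

/-! The constant function 1 is already a counterexample. Its image is `∑ μ_n z^n = ∫ (1 - t z)⁻¹
dμ(t)`, with derivative `∫ t / (1 - t z)² dμ(t)`. Put `s = 1 - Re z`. In the sector `|Im z| ≤ s / 2`
the integrand has nonnegative real part, and the `t` with `1 - t` comparable to `s` alone give
`|F'(z)| ≳ log(2/s)^(-β) / s` (`le_norm_deriv_cauchyTransform_logMeasure`). There `1 - |z|²` is
comparable to `s`, so the Besov integrand is at least a constant times `s⁻² log(2/s)^(-βp)`, hence
times `s⁻² / log(2/s)` because `βp ≤ 1`. A dyadic box at scale `2⁻ᵏ` has area of order `4⁻ᵏ` and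
contributes at least a constant over `k + 4`; the harmonic series diverges. -/

/-! ### Mass estimates and the Carleson condition. -/

theorem logMeasure_apply_of_subset (β : ℝ) {s : Set ℝ} (hs : MeasurableSet s)
    (hsub : s ⊆ Ico (0 : ℝ) 1) :
    logMeasure β s = ∫⁻ t in s, ENNReal.ofReal (Real.log (2 / (1 - t)) ^ (-β)) := by
  rw [logMeasure, withDensity_apply _ hs, Measure.restrict_restrict hs,
    inter_eq_self_of_subset_left hsub]

theorem logMeasure_le_of_log_le {β L : ℝ} (hβ : 0 ≤ β) (hL : 0 < L) {s : Set ℝ}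
    (hs : MeasurableSet s) (hsub : s ⊆ Ico (0 : ℝ) 1)
    (h : ∀ t ∈ s, L ≤ Real.log (2 / (1 - t))) :
    logMeasure β s ≤ ENNReal.ofReal (L ^ (-β)) * volume s := by
  rw [logMeasure_apply_of_subset β hs hsub, ← setLIntegral_const]
  refine setLIntegral_mono' hs fun t ht => ENNReal.ofReal_le_ofReal ?_
  exact Real.rpow_le_rpow_of_nonpos hL (h t ht) (by linarith)

theorem le_logMeasure_of_log_le {β L : ℝ} (hβ : 0 ≤ β) {s : Set ℝ}
    (hs : MeasurableSet s) (hsub : s ⊆ Ico (0 : ℝ) 1)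
    (h : ∀ t ∈ s, Real.log (2 / (1 - t)) ≤ L) :
    ENNReal.ofReal (L ^ (-β)) * volume s ≤ logMeasure β s := by
  rw [logMeasure_apply_of_subset β hs hsub, ← setLIntegral_const]
  refine setLIntegral_mono' hs fun t ht => ENNReal.ofReal_le_ofReal ?_
  have ht' := hsub ht
  refine Real.rpow_le_rpow_of_nonpos (Real.log_pos ?_) (h t ht) (by linarith)
  rw [lt_div_iff₀ (by linarith [ht'.2])]
  linarith [ht'.1]

theorem logMeasure_Ico_le {β h : ℝ} (hβ : 0 ≤ β) (h0 : 0 < h) (h1 : h ≤ 1) :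
    logMeasure β (Ico (1 - h) 1) ≤ ENNReal.ofReal (Real.log (2 / h) ^ (-β) * h) := by
  have hpos : 0 < Real.log (2 / h) := Real.log_pos (by rw [lt_div_iff₀ h0]; linarith)
  have := logMeasure_le_of_log_le hβ hpos (measurableSet_Ico (a := 1 - h) (b := 1))
    (Ico_subset_Ico_left (by linarith)) fun t ht => by
      refine Real.log_le_log (by positivity) ?_
      have := ht.2
      exact div_le_div_of_nonneg_left (by norm_num) (by linarith) (by linarith [ht.1])
  rwa [Real.volume_Ico, show 1 - (1 - h) = h by ring, ← ENNReal.ofReal_mul (by positivity)]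
    at this

theorem isFiniteMeasure_logMeasure {β : ℝ} (hβ : 0 ≤ β) : IsFiniteMeasure (logMeasure β) := by
  have h1 := logMeasure_Ico_le hβ one_pos le_rfl
  have h2 : logMeasure β univ = logMeasure β (Ico (1 - 1 : ℝ) 1) := by
    rw [logMeasure, withDensity_apply _ .univ, withDensity_apply _ measurableSet_Ico,
      Measure.restrict_restrict measurableSet_Ico]
    simp
  exact ⟨by rw [h2]; exact h1.trans_lt ENNReal.ofReal_lt_top⟩

/-- A Carleson square lies in the annulus `1 - h ≤ |z|`, so the position of the arc is irrelevant.
The tail mass `h log(2/h)^(-β)` absorbs `log(1/h)^β`, leaving `h ≤ l`. -/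
theorem isLogCarleson_logMeasure {β : ℝ} (hβ : 0 ≤ β) :
    IsLogCarleson β 1 (toDiscMeasure (logMeasure β)) := by
  refine ⟨1, one_pos, fun a l hl hl2 => ?_⟩
  set h := l / (2 * Real.pi) with hh
  have hπ := Real.pi_pos
  have h0 : 0 < h := by positivity
  have h1 : h ≤ 1 := by rw [hh, div_le_one (by positivity)]; exact hl2
  have hlh : 2 * Real.pi / l = 1 / h := by rw [hh, one_div_div]
  have hmeas : toDiscMeasure (logMeasure β) (carlesonSquare a l)
      ≤ logMeasure β (Ico (1 - h) 1) := by
    have hsub : carlesonSquare a l ⊆ {z : ℂ | 1 - h ≤ ‖z‖} := by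
      rintro z ⟨r, φ, hr, -, -, -, rfl⟩
      simp only [mem_ofPred_eq, norm_mul, Complex.norm_exp_ofReal_mul_I, mul_one,
        Complex.norm_real, Real.norm_eq_abs]
      exact hr.trans (le_abs_self r)
    have hcl : MeasurableSet {z : ℂ | 1 - h ≤ ‖z‖} :=
      (isClosed_le continuous_const continuous_norm).measurableSet
    have hof : Measurable (fun t : ℝ => (t : ℂ)) := Complex.measurable_ofReal
    refine (measure_mono hsub).trans ?_
    rw [toDiscMeasure, Measure.map_apply hof hcl, Measure.restrict_apply (hof hcl)]
    refine measure_mono fun t ht => ⟨?_, ht.2.2⟩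
    simpa [abs_of_nonneg ht.2.1] using ht.1
  have hlog1 : 0 ≤ Real.log (1 / h) := Real.log_nonneg (by rw [le_div_iff₀ h0]; linarith)
  have hlog2 : 0 < Real.log (2 / h) := Real.log_pos (by rw [lt_div_iff₀ h0]; linarith)
  have hprod : Real.log (2 / h) ^ (-β) * h * Real.log (1 / h) ^ β ≤ l := by
    have hle : Real.log (1 / h) ^ β ≤ Real.log (2 / h) ^ β :=
      Real.rpow_le_rpow hlog1 (Real.log_le_log (by positivity) (by gcongr; norm_num)) hβ
    calc Real.log (2 / h) ^ (-β) * h * Real.log (1 / h) ^ β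
        ≤ Real.log (2 / h) ^ (-β) * h * Real.log (2 / h) ^ β := by gcongr
      _ = h := by
          rw [Real.rpow_neg hlog2.le]
          have : Real.log (2 / h) ^ β ≠ 0 := (Real.rpow_pos_of_pos hlog2 β).ne'
          field_simp
      _ ≤ l := div_le_self hl.le (by linarith [Real.pi_gt_three])
  rw [Real.rpow_one, hlh, ENNReal.ofReal_one]
  refine ENNReal.div_le_of_le_mul ?_
  rw [one_mul]
  calc _ ≤ ENNReal.ofReal (Real.log (2 / h) ^ (-β) * h)
        * ENNReal.ofReal (Real.log (1 / h) ^ β) := by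
          gcongr
          exact hmeas.trans (logMeasure_Ico_le hβ h0 h1)
    _ ≤ ENNReal.ofReal l := by
          rw [← ENNReal.ofReal_mul (by positivity)]
          exact ENNReal.ofReal_le_ofReal hprod

/-! ### The Cauchy transform and its derivative. -/

/-- The Cauchy transform `∫_{[0,1)} (1 - t z)⁻¹ dμ(t)`. -/
noncomputable def cauchyTransform (μ : Measure ℝ) (z : ℂ) : ℂ :=
  ∫ t in Ico (0 : ℝ) 1, (1 - (t : ℂ) * z)⁻¹ ∂μ

theorem one_sub_norm_le_norm_one_sub_mul {t : ℝ} (ht : t ∈ Ico (0 : ℝ) 1) (z : ℂ) :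
    1 - ‖z‖ ≤ ‖1 - (t : ℂ) * z‖ := by
  have h1 : ‖(t : ℂ) * z‖ ≤ ‖z‖ := by
    rw [norm_mul, Complex.norm_real, Real.norm_of_nonneg ht.1]
    exact mul_le_of_le_one_left (norm_nonneg z) ht.2.le
  have h2 := norm_sub_norm_le (1 : ℂ) ((t : ℂ) * z)
  rw [norm_one] at h2
  linarith

theorem moment_ofReal_mul_pow (μ : Measure ℝ) (z : ℂ) (n : ℕ) :
    ∫ t in Ico (0 : ℝ) 1, ((t : ℂ) * z) ^ n ∂μ = (moment μ n : ℂ) * z ^ n := by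
  simp_rw [mul_pow]
  rw [integral_mul_const, moment, ← integral_complex_ofReal]
  simp

theorem hasSum_moment_mul_pow (μ : Measure ℝ) [IsFiniteMeasure μ] {z : ℂ} (hz : ‖z‖ < 1) :
    HasSum (fun n : ℕ => (moment μ n : ℂ) * z ^ n) (cauchyTransform μ z) := by
  have key := hasSum_integral_of_dominated_convergence
    (μ := μ.restrict (Ico (0 : ℝ) 1)) (F := fun (n : ℕ) (t : ℝ) => ((t : ℂ) * z) ^ n)
    (f := fun t => (1 - (t : ℂ) * z)⁻¹) (fun n _ => ‖z‖ ^ n)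
    (fun n => by fun_prop)
    (fun n => ?_) (.of_forall fun _ => summable_geometric_of_lt_one (norm_nonneg z) hz)
    (integrable_const _) ?_
  · simp only [moment_ofReal_mul_pow] at key
    exact key
  · filter_upwards [ae_restrict_mem measurableSet_Ico] with t ht
    rw [norm_pow, norm_mul, Complex.norm_real, Real.norm_of_nonneg ht.1]
    exact pow_le_pow_left₀ (mul_nonneg ht.1 (norm_nonneg z))
      (mul_le_of_le_one_left (norm_nonneg z) ht.2.le) n
  · filter_upwards [ae_restrict_mem measurableSet_Ico] with t ht
    refine hasSum_geometric_of_norm_lt_one ?_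
    rw [norm_mul, Complex.norm_real, Real.norm_of_nonneg ht.1]
    exact (mul_le_of_le_one_left (norm_nonneg z) ht.2.le).trans_lt hz

theorem hasDerivAt_cauchyTransform (μ : Measure ℝ) [IsFiniteMeasure μ] {z : ℂ} (hz : ‖z‖ < 1) :
    Integrable (fun t : ℝ => (t : ℂ) / (1 - (t : ℂ) * z) ^ 2) (μ.restrict (Ico (0 : ℝ) 1)) ∧
    HasDerivAt (cauchyTransform μ)
      (∫ t in Ico (0 : ℝ) 1, (t : ℂ) / (1 - (t : ℂ) * z) ^ 2 ∂μ) z := by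
  -- An intermediate radius keeps `1 - t w` uniformly away from 0 for `w` near `z`.
  obtain ⟨ρ, hzρ, hρ⟩ := exists_between hz
  have hlow : ∀ t ∈ Ico (0 : ℝ) 1, ∀ w ∈ Metric.ball (0 : ℂ) ρ,
      1 - ρ ≤ ‖1 - (t : ℂ) * w‖ := fun t ht w hw => by
    have := one_sub_norm_le_norm_one_sub_mul ht w
    rw [mem_ball_zero_iff] at hw
    linarith
  have hzmem : z ∈ Metric.ball (0 : ℂ) ρ := by rwa [mem_ball_zero_iff]
  refine hasDerivAt_integral_of_dominated_loc_of_deriv_le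
    (μ := μ.restrict (Ico (0 : ℝ) 1)) (F := fun (w : ℂ) (t : ℝ) => (1 - (t : ℂ) * w)⁻¹)
    (F' := fun (w : ℂ) (t : ℝ) => (t : ℂ) / (1 - (t : ℂ) * w) ^ 2)
    (bound := fun _ => 1 / (1 - ρ) ^ 2)
    (Metric.isOpen_ball.mem_nhds hzmem) (.of_forall fun w => ?_) ?_ ?_ ?_
    (integrable_const _) ?_
  · exact Measurable.aestronglyMeasurable (by fun_prop)
  · refine Integrable.of_bound (Measurable.aestronglyMeasurable (by fun_prop)) (1 - ρ)⁻¹ ?_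
    filter_upwards [ae_restrict_mem measurableSet_Ico] with t ht
    rw [norm_inv]
    exact inv_anti₀ (by linarith) (hlow t ht z hzmem)
  · exact Measurable.aestronglyMeasurable (by fun_prop)
  · filter_upwards [ae_restrict_mem measurableSet_Ico] with t ht w hw
    rw [norm_div, norm_pow, Complex.norm_real, Real.norm_of_nonneg ht.1]
    have := hlow t ht w hw
    have : 0 < 1 - ρ := by linarith
    gcongr
    exact ht.2.le
  · filter_upwards [ae_restrict_mem measurableSet_Ico] with t ht w hw
    have hne : 1 - (t : ℂ) * w ≠ 0 := by
      rw [← norm_pos_iff]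
      linarith [hlow t ht w hw]
    have h1 : HasDerivAt (fun w : ℂ => 1 - (t : ℂ) * w) (-(t : ℂ)) w := by
      simpa using ((hasDerivAt_id w).const_mul (t : ℂ)).const_sub 1
    simpa only [neg_neg] using h1.fun_inv hne

/-- With `w = x + iy` and `y² ≤ x²/4`, the numerator `x² - y²` is at least `3x²/4` and `|w|⁴` is at
most `25x⁴/16`. -/
theorem le_re_one_div_sq {w : ℂ} (hre : 0 < w.re) (him : |w.im| ≤ w.re / 2) :
    12 / (25 * w.re ^ 2) ≤ (1 / w ^ 2).re := by
  have hb : w.im ^ 2 ≤ w.re ^ 2 / 4 := by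
    rw [← sq_abs w.im]
    nlinarith [abs_nonneg w.im]
  have hval : (1 / w ^ 2).re = (w.re ^ 2 - w.im ^ 2) / (w.re ^ 2 + w.im ^ 2) ^ 2 := by
    rw [one_div, Complex.inv_re, Complex.normSq_apply]
    simp only [pow_two, Complex.mul_re, Complex.mul_im]
    congr 1
    ring
  rw [hval, div_le_div_iff₀ (by positivity) (by positivity)]
  have h1 : (w.re ^ 2 + w.im ^ 2) ^ 2 ≤ (5 / 4 * w.re ^ 2) ^ 2 := by gcongr; linarith
  nlinarith [sq_nonneg w.re]

/-! ### The test function 1 and the growth of the derivative of its image. -/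

theorem taylorCoeff_one (k : ℕ) : taylorCoeff (fun _ => 1) k = if k = 0 then 1 else 0 := by
  rcases k with _ | k
  · simp [taylorCoeff]
  · simp [taylorCoeff, iteratedDeriv_const]

theorem isHankelImage_one (μ : Measure ℝ) [IsFiniteMeasure μ] :
    IsHankelImage μ (fun _ => 1) (cauchyTransform μ) := by
  refine ⟨fun n => (moment μ n : ℂ), fun n => ?_, fun z hz => ?_⟩
  · refine tendsto_const_nhds.congr' ?_
    filter_upwards [eventually_gt_atTop 0] with N hN
    rw [Finset.sum_eq_single_of_mem 0 (Finset.mem_range.2 hN)]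
    · simp [taylorCoeff_one]
    · intro k _ hk
      simp [taylorCoeff_one, hk]
  · exact hasSum_moment_mul_pow μ (by simpa using hz)

theorem memBesov_const {p : ℝ} (hp : 0 < p) (c : ℂ) : MemBesov p (fun _ => c) := by
  refine ⟨differentiableOn_const c, ?_⟩
  have : besovIntegral p (fun _ => c) = 0 := by
    simp [besovIntegral, Real.zero_rpow hp.ne']
  rw [besovNorm, this, add_zero]
  finiteness

theorem le_norm_deriv_cauchyTransform_logMeasure {β : ℝ} (hβ : 0 ≤ β) {z : ℂ} {s : ℝ}
    (hs : 0 < s) (hs' : s ≤ 1 / 4) (hre : z.re = 1 - s) (him : |z.im| ≤ s / 2) :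
    Real.log (2 / s) ^ (-β) / (40 * s) ≤ ‖deriv (cauchyTransform (logMeasure β)) z‖ := by
  have := isFiniteMeasure_logMeasure hβ
  have hz : ‖z‖ < 1 := by
    have h1 : z.im ^ 2 ≤ (s / 2) ^ 2 := by rw [← sq_abs]; gcongr
    have h2 : ‖z‖ ^ 2 < 1 := by
      rw [← Complex.normSq_eq_norm_sq, Complex.normSq_apply, hre]
      nlinarith
    exact (sq_lt_one_iff₀ (norm_nonneg z)).1 h2
  obtain ⟨hint, hderiv⟩ := hasDerivAt_cauchyTransform (logMeasure β) hz
  have hpt : ∀ t ∈ Ico (0 : ℝ) 1,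
      t * (12 / (25 * (1 - t + t * s) ^ 2)) ≤ ((t : ℂ) / (1 - (t : ℂ) * z) ^ 2).re := by
    intro t ht
    have hwre : (1 - (t : ℂ) * z).re = 1 - t + t * s := by simp [hre]; ring
    have hwim : |(1 - (t : ℂ) * z).im| = t * |z.im| := by
      simp [abs_mul, abs_of_nonneg ht.1]
    have h1 := ht.1
    have h2 := ht.2
    -- The sector condition passes to `1 - t z`, as `t |Im z| ≤ t s / 2`.
    have h3 := le_re_one_div_sq (w := 1 - (t : ℂ) * z) (by rw [hwre]; nlinarith)
      (by rw [hwre, hwim]; nlinarith [mul_le_mul_of_nonneg_left him ht.1])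
    rw [hwre] at h3
    rw [div_eq_mul_one_div (t : ℂ), Complex.re_ofReal_mul]
    exact mul_le_mul_of_nonneg_left h3 ht.1
  -- On this window `s ≤ 1 - t ≤ 2s`, so the density is at least `log(2/s)^(-β)`, `|Re(1 - t z)| ≤
  -- 3s`, and `t ≥ 1/2` as `s ≤ 1/4`.
  have hsub : Icc (1 - 2 * s) (1 - s) ⊆ Ico (0 : ℝ) 1 := fun t ht =>
    ⟨by linarith [ht.1], by linarith [ht.2]⟩
  have hmass : Real.log (2 / s) ^ (-β) * s
      ≤ (logMeasure β).real (Icc (1 - 2 * s) (1 - s)) := by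
    have h := le_logMeasure_of_log_le (β := β) (L := Real.log (2 / s)) hβ measurableSet_Icc hsub
      fun t ht => Real.log_le_log (div_pos two_pos (by linarith [(hsub ht).2])) <|
        div_le_div_of_nonneg_left two_pos.le hs (by linarith [ht.2])
    have hlog : 0 ≤ Real.log (2 / s) := Real.log_nonneg (by rw [le_div_iff₀ hs]; linarith)
    rw [Real.volume_Icc, show 1 - s - (1 - 2 * s) = s by ring,
      ← ENNReal.ofReal_mul (by positivity)] at h
    exact (ENNReal.ofReal_le_iff_le_toReal (measure_ne_top _ _)).1 h
  have hwin : ∀ t ∈ Icc (1 - 2 * s) (1 - s),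
      1 / (40 * s ^ 2) ≤ ((t : ℂ) / (1 - (t : ℂ) * z) ^ 2).re := by
    intro t ht
    refine le_trans ?_ (hpt t (hsub ht))
    have h1 := ht.1
    have h2 := ht.2
    have h0 : 0 < 1 - t + t * s := by nlinarith
    have h3 : 1 - t + t * s ≤ 3 * s := by nlinarith
    calc 1 / (40 * s ^ 2) ≤ 1 / 2 * (12 / (25 * (3 * s) ^ 2)) := by
          rw [← mul_div_assoc, div_le_div_iff₀ (by positivity) (by positivity)]
          nlinarith [sq_nonneg s]
      _ ≤ t * (12 / (25 * (1 - t + t * s) ^ 2)) := by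
          gcongr <;> linarith
  have hre_int : IntegrableOn (fun t : ℝ => ((t : ℂ) / (1 - (t : ℂ) * z) ^ 2).re)
      (Ico (0 : ℝ) 1) (logMeasure β) := hint.re
  calc Real.log (2 / s) ^ (-β) / (40 * s)
      = 1 / (40 * s ^ 2) * (Real.log (2 / s) ^ (-β) * s) := by field_simp
    _ ≤ 1 / (40 * s ^ 2) * (logMeasure β).real (Icc (1 - 2 * s) (1 - s)) := by gcongr
    _ ≤ ∫ t in Icc (1 - 2 * s) (1 - s), ((t : ℂ) / (1 - (t : ℂ) * z) ^ 2).re ∂logMeasure β :=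
        setIntegral_ge_of_const_le_real
          (f := fun t : ℝ => ((t : ℂ) / (1 - (t : ℂ) * z) ^ 2).re) measurableSet_Icc (measure_ne_top _ _) hwin
          (hre_int.mono_set hsub)
    _ ≤ ∫ t in Ico (0 : ℝ) 1, ((t : ℂ) / (1 - (t : ℂ) * z) ^ 2).re ∂logMeasure β := by
        refine setIntegral_mono_set hre_int ?_ hsub.eventuallyLE
        filter_upwards [ae_restrict_mem measurableSet_Ico] with t ht
        exact le_trans (mul_nonneg ht.1 (by positivity)) (hpt t ht)
    _ = (deriv (cauchyTransform (logMeasure β)) z).re := by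
        rw [hderiv.deriv]
        exact integral_re hint
    _ ≤ _ := Complex.re_le_norm _

/-! ### Dyadic boxes and divergence of the Besov integral. -/

theorem Complex.volume_reProdIm (s t : Set ℝ) :
    volume (s ×ℂ t) = volume s * volume t := by
  rw [← Measure.prod_prod, ← Measure.volume_eq_prod,
    ← Complex.volume_preserving_equiv_real_prod.measure_preimage_equiv]
  rfl

theorem tsum_ofReal_div_natCast_add_eq_top {c : ℝ} (hc : 0 < c) (m : ℕ) :
    ∑' k : ℕ, ENNReal.ofReal (c / ((k + m : ℕ) : ℝ)) = ∞ := by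
  by_contra h
  have h1 := ENNReal.summable_toReal h
  have h2 : Summable fun k : ℕ => c / ((k + m : ℕ) : ℝ) := by
    refine h1.congr fun k => ENNReal.toReal_ofReal (by positivity)
  have h3 := (summable_nat_add_iff m (f := fun k : ℕ => c / (k : ℝ))).1 h2
  have h4 := h3.mul_left c⁻¹
  refine Real.not_summable_one_div_natCast (h4.congr fun k => ?_)
  rw [← mul_div_assoc, inv_mul_cancel₀ hc.ne']

/-- A box of side lengths `δ / 2`, where `δ = 2⁻ᵏ⁻²`, near the boundary point `1`. -/
def dyadicBox (k : ℕ) : Set ℂ :=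
  Ico (1 - (1 / 2 : ℝ) ^ (k + 2)) (1 - (1 / 2 : ℝ) ^ (k + 3)) ×ℂ
    Icc (-(1 / 2 : ℝ) ^ (k + 4)) ((1 / 2 : ℝ) ^ (k + 4))

theorem measurableSet_dyadicBox (k : ℕ) : MeasurableSet (dyadicBox k) :=
  (Complex.measurable_re measurableSet_Ico).inter (Complex.measurable_im measurableSet_Icc)

theorem volume_dyadicBox (k : ℕ) :
    volume (dyadicBox k) = ENNReal.ofReal (((1 / 2 : ℝ) ^ (k + 3)) ^ 2) := by
  rw [dyadicBox, Complex.volume_reProdIm, Real.volume_Ico, Real.volume_Icc,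
    ← ENNReal.ofReal_mul (by
      rw [pow_succ _ (k + 2)]
      linarith [pow_pos (one_half_pos (α := ℝ)) (k + 2)])]
  congr 1
  ring

theorem pairwise_disjoint_dyadicBox : Pairwise (Function.onFun Disjoint dyadicBox) := by
  have hlt : ∀ i j : ℕ, i < j → Disjoint (dyadicBox i) (dyadicBox j) := by
    intro i j hij
    rw [Set.disjoint_left]
    intro z hz hz'
    have h1 := hz.1.2
    have h2 := hz'.1.1
    have h3 : (1 / 2 : ℝ) ^ (j + 2) ≤ (1 / 2 : ℝ) ^ (i + 3) :=
      pow_le_pow_of_le_one (by norm_num) (by norm_num) (by omega)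
    linarith
  intro i j hij
  rcases lt_or_gt_of_ne hij with h | h
  · exact hlt i j h
  · exact (hlt j i h).symm

theorem dyadicBox_bounds {k : ℕ} {z : ℂ} (hz : z ∈ dyadicBox k) :
    (1 / 2 : ℝ) ^ (k + 3) < 1 - z.re ∧ 1 - z.re ≤ 2 * (1 / 2 : ℝ) ^ (k + 3) ∧
      1 - z.re ≤ 1 / 4 ∧ |z.im| ≤ (1 - z.re) / 2 ∧
      1 - z.re ≤ 1 - ‖z‖ ^ 2 ∧ 1 - ‖z‖ ^ 2 ≤ 2 * (1 - z.re) := by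
  obtain ⟨⟨h1, h2⟩, h3⟩ := hz
  have h4 : (1 / 2 : ℝ) ^ (k + 2) ≤ (1 / 2 : ℝ) ^ 2 :=
    pow_le_pow_of_le_one (by norm_num) (by norm_num) (by omega)
  have h5 : |z.im| ≤ (1 / 2 : ℝ) ^ (k + 4) := abs_le.2 h3
  have h6 : (1 / 2 : ℝ) ^ (k + 4) = (1 / 2) ^ (k + 3) / 2 := by ring
  have h7 : (1 / 2 : ℝ) ^ (k + 2) = 2 * (1 / 2) ^ (k + 3) := by ring
  have h8 : |z.im| ≤ (1 - z.re) / 2 := by linarith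
  have h9 : z.im ^ 2 ≤ ((1 - z.re) / 2) ^ 2 := by rw [← sq_abs]; gcongr
  have h10 : ‖z‖ ^ 2 = z.re ^ 2 + z.im ^ 2 := by
    rw [← Complex.normSq_eq_norm_sq, Complex.normSq_apply]; ring
  refine ⟨by linarith, by linarith, by linarith, h8, ?_, ?_⟩ <;> rw [h10] <;> nlinarith

/-- The minimum covers both signs of the exponent, which will be `p - 2`. -/
theorem min_mul_rpow_le {x s : ℝ} (q : ℝ) (hs : 0 < s) (h1 : s ≤ x) (h2 : x ≤ 2 * s) :
    min 1 (2 ^ q) * s ^ q ≤ x ^ q := by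
  have hsq : 0 < s ^ q := Real.rpow_pos_of_pos hs q
  rcases le_total 0 q with hq | hq
  · calc min 1 (2 ^ q) * s ^ q ≤ 1 * s ^ q := by gcongr; exact min_le_left _ _
      _ ≤ x ^ q := by rw [one_mul]; exact Real.rpow_le_rpow hs.le h1 hq
  · calc min 1 (2 ^ q) * s ^ q ≤ 2 ^ q * s ^ q := by gcongr; exact min_le_right _ _
      _ = (2 * s) ^ q := (Real.mul_rpow two_pos.le hs.le).symm
      _ ≤ x ^ q := Real.rpow_le_rpow_of_nonpos (hs.trans_le h1) h2 hq

theorem le_besov_integrand_on_dyadicBox {p β : ℝ} (hp : 0 < p) (hβ : 0 ≤ β) (hβp : β ≤ 1 / p)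
    {k : ℕ} {z : ℂ} (hz : z ∈ dyadicBox k) :
    min 1 (2 ^ (p - 2)) * (1 / 40) ^ p / 4 / ((1 / 2 : ℝ) ^ (k + 3)) ^ 2 / ((k + 4 : ℕ) : ℝ)
      ≤ (1 - ‖z‖ ^ 2) ^ (p - 2) * ‖deriv (cauchyTransform (logMeasure β)) z‖ ^ p := by
  obtain ⟨h1, h2, h3, h4, h5, h6⟩ := dyadicBox_bounds hz
  set s := 1 - z.re with hs
  set δ : ℝ := (1 / 2 : ℝ) ^ (k + 3) with hδ
  have hδ0 : 0 < δ := by positivity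
  have hs0 : 0 < s := hδ0.trans h1
  have hder := le_norm_deriv_cauchyTransform_logMeasure hβ hs0 h3 (by rw [hs]; ring) h4
  have hL1 : 1 ≤ Real.log (2 / s) := by
    rw [Real.le_log_iff_exp_le (by positivity), le_div_iff₀ hs0]
    nlinarith [Real.exp_one_lt_d9]
  have hL2 : Real.log (2 / s) ≤ ((k + 4 : ℕ) : ℝ) := by
    have : 2 / s ≤ 2 ^ (k + 4) := by
      rw [div_le_iff₀ hs0]
      calc (2 : ℝ) = 2 ^ (k + 4) * δ := by
            rw [hδ, pow_succ 2, mul_right_comm, ← mul_pow]; norm_num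
        _ ≤ _ := by gcongr
    calc Real.log (2 / s) ≤ Real.log (2 ^ (k + 4)) := Real.log_le_log (by positivity) this
      _ = ((k + 4 : ℕ) : ℝ) * Real.log 2 := Real.log_pow _ _
      _ ≤ _ := mul_le_of_le_one_right (by positivity) (by linarith [Real.log_two_lt_d9])
  set L := Real.log (2 / s)
  have hL0 : 0 < L := by linarith
  -- The hypothesis `βp ≤ 1` enters here: since `L ≥ 1`, `L^(-βp) ≥ L⁻¹`.
  have hLp : L⁻¹ ≤ (L ^ (-β)) ^ p := by
    rw [← Real.rpow_mul hL0.le, ← Real.rpow_neg_one]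
    refine Real.rpow_le_rpow_of_exponent_le hL1 ?_
    rw [le_div_iff₀ hp] at hβp
    linarith
  have hc : 0 < min 1 ((2 : ℝ) ^ (p - 2)) := lt_min one_pos (by positivity)
  calc _ = min 1 (2 ^ (p - 2)) * (1 / 40) ^ p * (1 / (2 * δ) ^ 2 * (((k + 4 : ℕ) : ℝ))⁻¹) := by
        field_simp
        norm_num
    _ ≤ min 1 (2 ^ (p - 2)) * (1 / 40) ^ p * (1 / s ^ 2 * (L ^ (-β)) ^ p) := by
        gcongr
        exact (inv_anti₀ hL0 hL2).trans hLp
    _ = (min 1 (2 ^ (p - 2)) * s ^ (p - 2)) * (L ^ (-β) / (40 * s)) ^ p := by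
        rw [Real.div_rpow (x := L ^ (-β)) (by positivity) (by positivity),
          Real.mul_rpow (by norm_num) hs0.le,
          Real.rpow_sub hs0, Real.rpow_two, Real.div_rpow one_pos.le (by norm_num), Real.one_rpow]
        have := (Real.rpow_pos_of_pos hs0 p).ne'
        field_simp
    _ ≤ _ := mul_le_mul (min_mul_rpow_le _ hs0 h5 h6)
        (Real.rpow_le_rpow (by positivity) hder hp.le) (by positivity)
        (Real.rpow_nonneg (hs0.le.trans h5) _)

theorem besovIntegral_cauchyTransform_logMeasure {p β : ℝ} (hp : 0 < p) (hβ : 0 ≤ β)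
    (hβp : β ≤ 1 / p) : besovIntegral p (cauchyTransform (logMeasure β)) = ∞ := by
  set c : ℝ := min 1 (2 ^ (p - 2)) * (1 / 40) ^ p / 4 with hcdef
  have hc : 0 < c := by
    have : 0 < min 1 ((2 : ℝ) ^ (p - 2)) := lt_min one_pos (by positivity)
    positivity
  have hsub : ⋃ k, dyadicBox k ⊆ Metric.ball (0 : ℂ) 1 := by
    refine iUnion_subset fun k z hz => ?_
    obtain ⟨h1, -, -, -, h5, -⟩ := dyadicBox_bounds hz
    have h0 : (0 : ℝ) < (1 / 2) ^ (k + 3) := by positivity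
    rw [mem_ball_zero_iff, ← sq_lt_one_iff₀ (norm_nonneg z)]
    linarith
  rw [besovIntegral, ENNReal.mul_eq_top]
  refine Or.inl ⟨by simp, top_unique ?_⟩
  refine le_trans ?_ (lintegral_mono_set hsub)
  rw [lintegral_iUnion measurableSet_dyadicBox pairwise_disjoint_dyadicBox,
    ← tsum_ofReal_div_natCast_add_eq_top hc 4]
  refine ENNReal.tsum_le_tsum fun k => ?_
  -- The area of the box cancels the factor `δ⁻²` of the pointwise bound.
  calc ENNReal.ofReal (c / ((k + 4 : ℕ) : ℝ))
      = ENNReal.ofReal (c / ((1 / 2 : ℝ) ^ (k + 3)) ^ 2 / ((k + 4 : ℕ) : ℝ))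
          * volume (dyadicBox k) := by
        rw [volume_dyadicBox, ← ENNReal.ofReal_mul (by positivity)]
        congr 1
        field_simp
    _ ≤ _ := by
        rw [← setLIntegral_const]
        exact setLIntegral_mono' (measurableSet_dyadicBox k) fun z hz =>
          ENNReal.ofReal_le_ofReal (le_besov_integrand_on_dyadicBox hp hβ hβp hz)

theorem mainTheorem7 (p β : ℝ) (hp : 1 < p) (hβ : 0 < β) (hβp : β ≤ 1 / p) :
    IsFiniteMeasure (logMeasure β) ∧
    IsLogCarleson β 1 (toDiscMeasure (logMeasure β)) ∧
    ∃ f F : ℂ → ℂ, MemBesov p f ∧ IsHankelImage (logMeasure β) f F ∧ ¬ MemBesov p F := by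
  have hp0 : 0 < p := one_pos.trans hp
  have := isFiniteMeasure_logMeasure hβ.le
  refine ⟨this, isLogCarleson_logMeasure hβ.le, fun _ => 1, cauchyTransform (logMeasure β),
    memBesov_const hp0 1, isHankelImage_one _, fun h => ?_⟩
  have h2 := h.2
  rw [besovNorm, besovIntegral_cauchyTransform_logMeasure hp0 hβ.le hβp, add_top,
    ENNReal.top_rpow_of_pos (by positivity)] at h2
  exact h2.ne rfl
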